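/- Let $E$ be a real vector lattice with a uo-Lebesgue topology $\tau$: a Hausdorff linear topology such that zero has a neighbourhood basis of solid sets, and such that $x_\alpha\to x$ in $\tau$ for every net $(x_\alpha)$ in $E$ that is uo-convergent to $x\in E$. (Such an $E$ is Archimedean.) Here a net $(x_\alpha)$ is order convergent to $x$ if there is a net $y_\beta\downarrow 0$ in $E$ such that for every $\beta$ there is an $\alpha_0$ with $|x_\alpha-x|\le y_\beta$ for all $\alpha\ge\alpha_0$, and it is uo-convergent to $x$ if $|x_\alpha-x|\wedge|y|$ is order convergent to $0$ for every $y\in E$. The carrier $C_\tau$ of $\tau$ is the union of the disjoint complements $\left(\bigcap_n V_n\right)^{\mathrm d}$, where $(V_n)_{n\ge 1}$ runs over the sequences of solid $\tau$-neighbourhoods of zero such that $V_{n+1}+V_{n+1}\subseteq V_n$ for all $n$. The vector lattice $E$ has the countable sup property if every subset of $E$ with a supremum in $E$ contains an at most countable subset with the same supremum. A countable order basis of $C_\tau$ is a non-empty, at most countable subset of $C_\tau$ whose disjoint complement in $C_\tau$ is $\{0\}$. For $A\subseteq E$, the $\sigma$-$\tau$-adherence, the $\sigma$-uo-adherence and the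 uo-adherence of $A$ are the sets of all limits in $E$ of, respectively, $\tau$-convergent sequences in $A$, uo-convergent sequences in $A$, and uo-convergent nets in $A$. For each of the three, the sets that are equal to their own adherence are the closed sets of a topology on $E$, called the $\sigma$-$\tau$-topology, the $\sigma$-uo-topology and the uo-topology, respectively; closures in these are called the $\sigma$-$\tau$-closure, the $\sigma$-uo-closure and the uo-closure. Theorem. 1. $C_\tau=E$ if and only if $E$ has the countable sup property. This is the case when $C_\tau$ has a countable order basis, and also when $\tau$ is metrisable. 2. Suppose that $C_\tau=E$ or, equivalently, that $E$ has the countable sup property. Then, for every $A\subseteq E$, the following seven subsets of $E$ are all equal: the $\sigma$-$\tau$-adherence and the $\sigma$-$\tau$-closure of $A$; the $\sigma$-uo-adherence and the $\sigma$-uo-closure of $A$; the uo-adherence and the uo-closure of $A$; and the $\tau$-closure of $A$. In particular, the $\sigma$-$\tau$-topology, the $\sigma$-uo-topology and the uo-topology on $E$ all coincide with $\tau$. -/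

import Mathlib

open Set Filter Topology

universe u v w

namespace VectorLattice

section Convergence

variable {E : Type u} [AddCommGroup E] [Lattice E]

/-- `x` is order convergent to `l`: some net `y`, indexed by a directed set, decreases to `0` and
each `y k` eventually dominates `|x - l|`. As only the range of `y` matters, restricting the index
sets of the dominating nets to the universe of `E` is no loss of generality. -/
def OrderConv {ι : Type v} [Preorder ι] (x : ι → E) (l : E) : Prop :=
  ∃ (κ : Type u) (_ : Preorder κ) (_ : IsDirectedOrder κ) (_ : Nonempty κ) (y : κ → E),
    Antitone y ∧ IsGLB (range y) 0 ∧ ∀ k : κ, ∃ i₀ : ι, ∀ i : ι, i₀ ≤ i → |x i - l| ≤ y k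

/-- Unbounded order convergence of the net `x` to `l`. -/
def UOConv {ι : Type v} [Preorder ι] (x : ι → E) (l : E) : Prop :=
  ∀ y : E, OrderConv (fun i => |x i - l| ⊓ |y|) 0

/-- Limits in `E` of uo-convergent sequences in `A`. -/
def sigmaUOAdherence (A : Set E) : Set E :=
  {l | ∃ x : ℕ → E, (∀ n, x n ∈ A) ∧ UOConv x l}

/-- Limits in `E` of uo-convergent nets in `A`. Convergence of a net depends only on its filter of
tails, a filter on `E`, so that index sets in the universe of `E` suffice. -/
def uoAdherence (A : Set E) : Set E :=
  {l | ∃ (ι : Type u) (_ : Preorder ι) (_ : IsDirectedOrder ι) (_ : Nonempty ι) (x : ι → E),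
    (∀ i, x i ∈ A) ∧ UOConv x l}

theorem OrderConv.comp {ι : Type v} {κ : Type w} [Preorder ι] [Preorder κ] {x : ι → E} {l : E}
    (h : OrderConv x l) (φ : κ → ι) (hφ : ∀ i₀, ∃ k₀, ∀ k, k₀ ≤ k → i₀ ≤ φ k) :
    OrderConv (fun k => x (φ k)) l := by
  obtain ⟨β, h1, h2, h3, y, hy, hy0, hd⟩ := h
  refine ⟨β, h1, h2, h3, y, hy, hy0, fun b => ?_⟩
  obtain ⟨i₀, hi⟩ := hd b
  obtain ⟨k₀, hk⟩ := hφ i₀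
  exact ⟨k₀, fun k hkk => hi _ (hk k hkk)⟩

theorem UOConv.comp {ι : Type v} {κ : Type w} [Preorder ι] [Preorder κ] {x : ι → E} {l : E}
    (h : UOConv x l) (φ : κ → ι) (hφ : ∀ i₀, ∃ k₀, ∀ k, k₀ ≤ k → i₀ ≤ φ k) :
    UOConv (fun k => x (φ k)) l := fun y => (h y).comp φ hφ

theorem uoConv_const [IsOrderedAddMonoid E] {ι : Type v} [Preorder ι] [Nonempty ι] (l : E) :
    UOConv (fun _ : ι => l) l := by
  intro y
  obtain ⟨i⟩ := ‹Nonempty ι›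
  refine ⟨PUnit, inferInstance, inferInstance, inferInstance, fun _ => 0, fun _ _ _ => le_rfl, ?_,
    fun _ => ⟨i, fun _ _ => ?_⟩⟩
  · rw [range_const]
    exact isGLB_singleton
  · simp

/-- A cofinal part of a uo-convergent net is a uo-convergent net. -/
theorem mem_uoAdherence_of_cofinal {ι : Type u} [Preorder ι] [IsDirectedOrder ι] [Nonempty ι]
    {x : ι → E} {l : E} (hl : UOConv x l) {A : Set E} (h : ∀ i, ∃ j, i ≤ j ∧ x j ∈ A) :
    l ∈ uoAdherence A := by
  refine ⟨{i : ι // x i ∈ A}, inferInstance, ⟨fun a b => ?_⟩, ?_, fun i => x i.1,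
    fun i => i.2, hl.comp Subtype.val fun i => ?_⟩
  · obtain ⟨c, hac, hbc⟩ := exists_ge_ge a.1 b.1
    obtain ⟨d, hcd, hd⟩ := h c
    exact ⟨⟨d, hd⟩, hac.trans hcd, hbc.trans hcd⟩
  · obtain ⟨i⟩ := ‹Nonempty ι›
    obtain ⟨j, _, hj⟩ := h i
    exact ⟨⟨j, hj⟩⟩
  · obtain ⟨j, hij, hj⟩ := h i
    exact ⟨⟨j, hj⟩, fun k hk => hij.trans hk⟩

end Convergence

/-- The topology whose closed sets are the fixed sets `adh A = A` of an adherence operator. -/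
@[reducible] def topologyOfAdherence {X : Type u} (adh : Set X → Set X) (h_empty : adh ∅ = ∅)
    (h_sub : ∀ A, A ⊆ adh A) (h_mono : ∀ A B, A ⊆ B → adh A ⊆ adh B)
    (h_union : ∀ A B, adh (A ∪ B) ⊆ adh A ∪ adh B) : TopologicalSpace X :=
  TopologicalSpace.ofClosed {A | adh A = A} h_empty
    (fun T hT => (subset_sInter fun A hA =>
      (h_mono _ _ (sInter_subset_of_mem hA)).trans (hT hA).subset).antisymm (h_sub _))
    (fun A (hA : adh A = A) B (hB : adh B = B) => by
      refine Subset.antisymm ?_ (h_sub _)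
      have h := h_union A B
      rwa [hA, hB] at h)

/-- A sequence in `A ∪ B` has a subsequence in `A` or a subsequence in `B`. -/
theorem exists_subseq_mem {X : Type u} {A B : Set X} {x : ℕ → X} (hx : ∀ n, x n ∈ A ∪ B) :
    (∃ φ : ℕ → ℕ, StrictMono φ ∧ ∀ n, x (φ n) ∈ A) ∨
      (∃ φ : ℕ → ℕ, StrictMono φ ∧ ∀ n, x (φ n) ∈ B) := by
  by_cases h : ∃ᶠ n in atTop, x n ∈ A
  · exact Or.inl (extraction_of_frequently_atTop h)
  · refine Or.inr (extraction_of_frequently_atTop (P := fun n => x n ∈ B) ?_)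
    refine ((not_frequently.mp h).mono fun n hn => ?_).frequently
    exact (hx n).resolve_left hn

section Topologies

/-- The σ-τ-topology of the topology `τ` of `X`: its closed sets are the `A` that are equal to their
σ-τ-adherence, the set of limits of τ-convergent sequences in `A`. -/
@[reducible] def sigmaTopology (X : Type u) [TopologicalSpace X] : TopologicalSpace X :=
  topologyOfAdherence (seqClosure : Set X → Set X)
    (eq_empty_of_forall_notMem fun _ ⟨_, hx, _⟩ => hx 0)
    (fun _ => subset_seqClosure)
    (fun _ _ h _ ⟨x, hx, hl⟩ => ⟨x, fun n => h (hx n), hl⟩)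
    (fun _ _ _ ⟨x, hx, hl⟩ => (exists_subseq_mem hx).imp
      (fun ⟨φ, hφ, h⟩ => ⟨x ∘ φ, h, hl.comp hφ.tendsto_atTop⟩)
      (fun ⟨φ, hφ, h⟩ => ⟨x ∘ φ, h, hl.comp hφ.tendsto_atTop⟩))

variable (E : Type u) [AddCommGroup E] [Lattice E] [IsOrderedAddMonoid E]

/-- The σ-uo-topology of `E`: its closed sets are the `A` with `sigmaUOAdherence A = A`. -/
@[reducible] def sigmaUOTopology : TopologicalSpace E :=
  topologyOfAdherence (sigmaUOAdherence : Set E → Set E)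
    (eq_empty_of_forall_notMem fun _ ⟨_, hx, _⟩ => hx 0)
    (fun _ l hl => ⟨fun _ => l, fun _ => hl, uoConv_const l⟩)
    (fun _ _ h _ ⟨x, hx, hl⟩ => ⟨x, fun n => h (hx n), hl⟩)
    (fun _ _ _ ⟨x, hx, hl⟩ => (exists_subseq_mem hx).imp
      (fun ⟨φ, hφ, h⟩ => ⟨x ∘ φ, h, hl.comp φ fun i => ⟨i, fun _ hk => hk.trans (hφ.id_le _)⟩⟩)
      (fun ⟨φ, hφ, h⟩ => ⟨x ∘ φ, h, hl.comp φ fun i => ⟨i, fun _ hk => hk.trans (hφ.id_le _)⟩⟩))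

/-- The uo-topology of `E`: its closed sets are the `A` with `uoAdherence A = A`. -/
@[reducible] def uoTopology : TopologicalSpace E :=
  topologyOfAdherence (uoAdherence : Set E → Set E)
    (eq_empty_of_forall_notMem fun _ ⟨_, _, _, ⟨i⟩, _, hx, _⟩ => hx i)
    (fun _ l hl => ⟨PUnit, inferInstance, inferInstance, inferInstance, fun _ => l, fun _ => hl,
      uoConv_const l⟩)
    (fun _ _ h _ ⟨ι, h1, h2, h3, x, hx, hl⟩ => ⟨ι, h1, h2, h3, x, fun n => h (hx n), hl⟩)
    (fun A B l ⟨ι, h1, h2, h3, x, hx, hl⟩ => by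
      by_cases h : ∀ i, ∃ j, i ≤ j ∧ x j ∈ A
      · exact Or.inl (mem_uoAdherence_of_cofinal hl h)
      · push Not at h
        obtain ⟨i₀, hi₀⟩ := h
        refine Or.inr (mem_uoAdherence_of_cofinal hl fun i => ?_)
        obtain ⟨j, hj₀, hj⟩ := exists_ge_ge i₀ i
        exact ⟨j, hj, (hx j).resolve_left (hi₀ j hj₀)⟩)

end Topologies

section LocallySolid

variable (E : Type u) [AddCommGroup E] [Lattice E] [TopologicalSpace E]

/-- The topology of `E` is a locally solid topology: a Hausdorff linear topology such that zero has a
neighbourhood basis of solid sets. -/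
structure IsLocallySolid [Module ℝ E] : Prop where
  t2Space : T2Space E
  isTopologicalAddGroup : IsTopologicalAddGroup E
  continuousSMul : ContinuousSMul ℝ E
  exists_solid : ∀ U ∈ 𝓝 (0 : E), ∃ V ∈ 𝓝 (0 : E), LatticeOrderedAddCommGroup.IsSolid V ∧ V ⊆ U

/-- The topology of `E` is a uo-Lebesgue topology: it is locally solid, and every uo-convergent net
converges to the same limit in the topology. -/
structure IsUOLebesgue [Module ℝ E] : Prop extends IsLocallySolid E where
  tendsto_of_uoConv : ∀ (ι : Type u) [Preorder ι] [IsDirectedOrder ι] [Nonempty ι]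
    (x : ι → E) (l : E), UOConv x l → Tendsto x atTop (𝓝 l)

variable {E}

/-- The disjoint complement of a subset of `E`. -/
def disjointComplement {E : Type u} [AddCommGroup E] [Lattice E] (N : Set E) : Set E :=
  {x | ∀ y ∈ N, |x| ⊓ |y| = 0}

/-- Normal sequences of solid neighbourhoods of zero. -/
def IsNormalSeq (V : ℕ → Set E) : Prop :=
  (∀ n, V n ∈ 𝓝 (0 : E)) ∧ (∀ n, LatticeOrderedAddCommGroup.IsSolid (V n)) ∧
    ∀ n, ∀ a ∈ V (n + 1), ∀ b ∈ V (n + 1), a + b ∈ V n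

variable (E) in
/-- The carrier of the topology of `E`. -/
def carrier : Set E :=
  {x | ∃ V : ℕ → Set E, IsNormalSeq V ∧ x ∈ disjointComplement (⋂ n, V n)}

end LocallySolid

/-- The countable sup property. -/
def CountableSupProperty (E : Type u) [Lattice E] : Prop :=
  ∀ (S : Set E) (s : E), IsLUB S s → ∃ T ⊆ S, T.Countable ∧ IsLUB T s

/-- The vector sublattice `F` of `E` has an at most countable order basis: a nonempty, at most
countable subset whose disjoint complement in `F` is zero. -/
def HasCountableOrderBasis {E : Type u} [AddCommGroup E] [Lattice E] (F : Set E) : Prop :=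
  ∃ B ⊆ F, B.Nonempty ∧ B.Countable ∧ F ∩ disjointComplement B = {0}

end VectorLattice

/-! For a normal sequence `V`, write N for `⋂ n, V n`. Two principles carry the proof: a downward
directed set with infimum 0 meets every neighbourhood of 0 (`exists_mem_of_isGLB`), and a vector in
both N and its disjoint complement is 0. Countably many normal sequences merge diagonally into one,
so countably many carrier elements share a single `V`.

The carrier is order dense (`exists_mem_carrier`). Hence every positive x is a supremum of carrier
elements; the countable sup property makes countably many suffice, and a common `V` puts x in the
carrier. Conversely, finite suprema taken from a set approximate its supremum within every `V n`,
and the error left by countably many of them lies in N and in its disjoint complement.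

For the adherences, the key inclusion is that of the closure in the σ-uo-adherence. If `x n - l`
lies in `V n` and is disjoint from N, then `x` is uo-convergent to `l` (`uoConv_of_mem`). When the
carrier is everything, such a sequence is built term by term, with `V` assembled from the normal
sequences of the terms themselves. The remaining inclusions come from the uo-Lebesgue property. -/

namespace VectorLattice

open LatticeOrderedAddCommGroup (IsSolid)

/-! ### Order-theoretic preliminaries and Archimedean arguments -/

section Basic

variable {E : Type u} [AddCommGroup E] [Lattice E]

/-- A downward directed set with infimum `0` that eventually dominates `|x - l|` witnesses order
convergence. -/
theorem orderConv_of_set {ι : Type v} [Preorder ι] {x : ι → E} {l : E} {D : Set E}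
    (hne : D.Nonempty) (hdir : ∀ a ∈ D, ∀ b ∈ D, ∃ c ∈ D, c ≤ a ∧ c ≤ b) (hD : IsGLB D 0)
    (h : ∀ d ∈ D, ∃ i₀, ∀ i, i₀ ≤ i → |x i - l| ≤ d) : OrderConv x l := by
  refine ⟨(↥D)ᵒᵈ, inferInstance, ⟨fun a b => ?_⟩, ?_, fun d => (OrderDual.ofDual d).1, ?_, ?_, ?_⟩
  · obtain ⟨c, hc, hca, hcb⟩ := hdir _ (OrderDual.ofDual a).2 _ (OrderDual.ofDual b).2
    exact ⟨OrderDual.toDual ⟨c, hc⟩, hca, hcb⟩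
  · obtain ⟨d, hd⟩ := hne
    exact ⟨OrderDual.toDual ⟨d, hd⟩⟩
  · exact fun a b hab => hab
  · convert hD
    ext z
    exact ⟨fun ⟨d, hd⟩ => hd ▸ (OrderDual.ofDual d).2, fun hz => ⟨OrderDual.toDual ⟨z, hz⟩, rfl⟩⟩
  · exact fun d => h _ (OrderDual.ofDual d).2

variable [IsOrderedAddMonoid E]

/-- The sum of disjoint vectors is their supremum. -/
theorem add_le_of_inf_eq_zero {a b c : E} (h : a ⊓ b = 0) (ha : a ≤ c) (hb : b ≤ c) :
    a + b ≤ c := by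
  rw [← inf_add_sup a b, h, zero_add]
  exact sup_le ha hb

omit [IsOrderedAddMonoid E] in
theorem inf_eq_zero_of_le {a b a' b' : E} (h : a ⊓ b = 0) (ha : 0 ≤ a') (hb : 0 ≤ b')
    (haa : a' ≤ a) (hbb : b' ≤ b) : a' ⊓ b' = 0 :=
  le_antisymm ((inf_le_inf haa hbb).trans h.le) (le_inf ha hb)

theorem mem_of_abs_mem {V : Set E} (hV : IsSolid V) {x : E} (h : |x| ∈ V) : x ∈ V :=
  hV h (abs_abs x).ge

theorem mem_of_nonneg_of_le {V : Set E} (hV : IsSolid V) {x y : E} (h : y ∈ V) (hx : 0 ≤ x)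
    (hxy : x ≤ y) : x ∈ V :=
  hV h (by rw [abs_of_nonneg hx, abs_of_nonneg (hx.trans hxy)]; exact hxy)

theorem add_inf_le_of_nonneg {a b c : E} (ha : 0 ≤ a) (hb : 0 ≤ b) (hc : 0 ≤ c) :
    (a + b) ⊓ c ≤ a ⊓ c + b ⊓ c := by
  rw [add_inf, inf_add, inf_add]
  refine le_inf (le_inf inf_le_left ?_) (le_inf ?_ ?_)
  · exact inf_le_right.trans (le_add_of_nonneg_right hb)
  · exact inf_le_right.trans (le_add_of_nonneg_left ha)
  · exact inf_le_right.trans (le_add_of_nonneg_left hc)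

/-- The Archimedean property of the order. -/
def IsArchimedean (E : Type u) [AddCommGroup E] [Lattice E] : Prop :=
  ∀ w z : E, 0 ≤ w → (∀ n : ℕ, n • w ≤ z) → w = 0

/-- If subtracting `w ≥ 0` leaves a nonempty set of nonnegative vectors invariant, then `w = 0`. -/
theorem IsArchimedean.eq_zero_of_sub_mem (hE : IsArchimedean E) {D : Set E} (hne : D.Nonempty)
    {b w : E} (hb : ∀ d ∈ D, b ≤ d) (hw : 0 ≤ w) (h : ∀ d ∈ D, d - w ∈ D) : w = 0 := by
  obtain ⟨d, hd⟩ := hne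
  have key : ∀ n : ℕ, d - n • w ∈ D := by
    intro n
    induction n with
    | zero => simpa using hd
    | succ n ih =>
      rw [succ_nsmul, ← sub_sub]
      exact h _ ih
  exact hE w (d - b) hw fun n => le_sub_comm.mp (hb _ (key n))

/-- The differences between the upper bounds of a nonempty set that is bounded above and its
members have infimum `0`. -/
theorem IsArchimedean.isGLB_upperBounds_sub (hE : IsArchimedean E) {S : Set E} (hne : S.Nonempty)
    (hbdd : BddAbove S) : IsGLB {d | ∃ z ∈ upperBounds S, ∃ s ∈ S, d = z - s} 0 := by
  refine ⟨?_, fun w hw => ?_⟩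
  · rintro _ ⟨z, hz, s, hs, rfl⟩
    exact sub_nonneg.mpr (hz hs)
  · have hw' : ∀ z ∈ upperBounds S, z - w ⊔ 0 ∈ upperBounds S := by
      intro z hz s hs
      have h1 : w ⊔ 0 ≤ z - s := sup_le (hw ⟨z, hz, s, hs, rfl⟩) (sub_nonneg.mpr (hz hs))
      exact le_sub_comm.mp h1
    obtain ⟨s, hs⟩ := hne
    have := hE.eq_zero_of_sub_mem hbdd (b := s) (fun z hz => hz hs) le_sup_right hw'
    exact le_sup_left.trans this.le

/-- In an Archimedean vector lattice, every positive vector is the supremum of the positive vectors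
below it in an order dense additive set. -/
theorem IsArchimedean.isLUB_of_dense (hE : IsArchimedean E) {I : Set E}
    (h0 : (0 : E) ∈ I) (hadd : ∀ a ∈ I, ∀ b ∈ I, a + b ∈ I) {w : E} (hw : 0 ≤ w)
    (hdense : ∀ v, 0 ≤ v → v ≤ w → v ≠ 0 → ∃ z ∈ I, 0 ≤ z ∧ z ≤ v ∧ z ≠ 0) :
    IsLUB (I ∩ Icc 0 w) w := by
  refine ⟨fun p hp => hp.2.2, fun t ht => ?_⟩
  by_contra hcon
  have ht0 : 0 ≤ t := ht ⟨h0, le_rfl, hw⟩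
  have hv : w - t ⊓ w ≠ 0 := fun h => hcon (inf_eq_right.mp (sub_eq_zero.mp h).symm)
  obtain ⟨z, hz, hz0, hzv, hzne⟩ := hdense (w - t ⊓ w) (sub_nonneg.mpr inf_le_right)
    (sub_le_self _ (le_inf ht0 hw)) hv
  refine hzne ?_
  have key : ∀ n : ℕ, n • z ∈ I ∩ Icc 0 w := by
    intro n
    induction n with
    | zero => simpa using ⟨h0, hw⟩
    | succ n ih =>
      rw [succ_nsmul]
      refine ⟨hadd _ ih.1 _ hz, add_nonneg ih.2.1 hz0, ?_⟩
      calc n • z + z ≤ t ⊓ w + (w - t ⊓ w) := add_le_add (le_inf (ht ih) ih.2.2) hzv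
        _ = w := by abel
  exact hE z w hz0 fun n => (key n).2.2

theorem isSolid_disjointComplement (N : Set E) : IsSolid (disjointComplement N) :=
  fun _ hx _ hyx z hz => inf_eq_zero_of_le (hx z hz) (abs_nonneg _) (abs_nonneg _) hyx le_rfl

theorem add_mem_disjointComplement {N : Set E} {a b : E} (ha : a ∈ disjointComplement N)
    (hb : b ∈ disjointComplement N) : a + b ∈ disjointComplement N := by
  intro z hz
  refine le_antisymm ?_ (le_inf (abs_nonneg _) (abs_nonneg _))
  calc |a + b| ⊓ |z| ≤ (|a| + |b|) ⊓ |z| := inf_le_inf_right _ (abs_add_le a b)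
    _ ≤ |a| ⊓ |z| + |b| ⊓ |z| :=
      add_inf_le_of_nonneg (abs_nonneg _) (abs_nonneg _) (abs_nonneg _)
    _ = 0 := by rw [ha z hz, hb z hz, add_zero]

omit [IsOrderedAddMonoid E] in
theorem disjointComplement_anti {M N : Set E} (h : M ⊆ N) :
    disjointComplement N ⊆ disjointComplement M :=
  fun _ hx y hy => hx y (h hy)

theorem eq_zero_of_mem_disjointComplement {N : Set E} {w : E} (h : w ∈ N)
    (h' : w ∈ disjointComplement N) : w = 0 := by
  have h0 : |w| = 0 := by simpa using h' w h
  exact le_antisymm ((le_abs_self w).trans h0.le) (neg_nonpos.mp ((neg_le_abs w).trans h0.le))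

end Basic

/-! ### Normal sequences, their diagonals and the carrier -/

section NormalSequences

variable {E : Type u} [AddCommGroup E] [Lattice E] [TopologicalSpace E]
  {V : ℕ → Set E}

theorem IsNormalSeq.zero_mem (hV : IsNormalSeq V) (n : ℕ) : (0 : E) ∈ V n :=
  mem_of_mem_nhds (hV.1 n)

theorem IsNormalSeq.antitone (hV : IsNormalSeq V) : Antitone V :=
  antitone_nat_of_succ_le fun n a ha => by
    simpa using hV.2.2 n a ha 0 (hV.zero_mem _)

theorem IsNormalSeq.isSolid_iInter (hV : IsNormalSeq V) : IsSolid (⋂ n, V n) :=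
  fun _ hx _ hyx => mem_iInter.mpr fun n => hV.2.1 n (mem_iInter.mp hx n) hyx

theorem IsNormalSeq.zero_mem_iInter (hV : IsNormalSeq V) : (0 : E) ∈ ⋂ n, V n :=
  mem_iInter.mpr hV.zero_mem

theorem IsNormalSeq.add_mem_iInter (hV : IsNormalSeq V) {a b : E} (ha : a ∈ ⋂ n, V n)
    (hb : b ∈ ⋂ n, V n) : a + b ∈ ⋂ n, V n :=
  mem_iInter.mpr fun n => hV.2.2 n a (mem_iInter.mp ha _) b (mem_iInter.mp hb _)

/-- The tails of a series with `n`-th term in `V n` are small. -/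
theorem IsNormalSeq.sum_mem (hV : IsNormalSeq V) {a : ℕ → E} (ha : ∀ n, a n ∈ V n) (k n : ℕ) :
    ∑ j ∈ Finset.range k, a (n + 1 + j) ∈ V n := by
  induction k generalizing n with
  | zero => simpa using hV.zero_mem n
  | succ k ih =>
    rw [Finset.sum_range_succ']
    refine hV.2.2 n _ ?_ _ (by simpa using ha (n + 1))
    simpa only [Nat.add_assoc, Nat.add_comm 1] using ih (n + 1)

/-- The diagonal intersection of a sequence of normal sequences. -/
def diagonalInter (V : ℕ → ℕ → Set E) (n : ℕ) : Set E := ⋂ i < n, V i n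

theorem isNormalSeq_diagonalInter {V : ℕ → ℕ → Set E} (hV : ∀ i, IsNormalSeq (V i)) :
    IsNormalSeq (diagonalInter V) := by
  refine ⟨fun n => ?_, fun n x hx y hyx => ?_, fun n a ha b hb => ?_⟩
  · exact (biInter_mem (finite_lt_nat n)).mpr fun i _ => (hV i).1 n
  · exact mem_iInter₂.mpr fun i hi => (hV i).2.1 n (mem_iInter₂.mp hx i hi) hyx
  · exact mem_iInter₂.mpr fun i hi => (hV i).2.2 n a (mem_iInter₂.mp ha i (hi.trans n.lt_succ_self))
      b (mem_iInter₂.mp hb i (hi.trans n.lt_succ_self))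

theorem iInter_diagonalInter_subset {V : ℕ → ℕ → Set E} (hV : ∀ i, IsNormalSeq (V i)) (i : ℕ) :
    ⋂ n, diagonalInter V n ⊆ ⋂ n, V i n := by
  intro x hx
  -- The `i`-th sequence enters the diagonal only from index `i + 1` on.
  refine mem_iInter.mpr fun n => (hV i).antitone (le_max_left n (i + 1)) ?_
  exact mem_iInter₂.mp (mem_iInter.mp hx (max n (i + 1))) i
    (lt_max_of_lt_right i.lt_succ_self)

/-- Countably many members of the carrier have a common normal sequence. -/
theorem exists_isNormalSeq_of_countable {B : Set E} (hB : B ⊆ carrier E) (hc : B.Countable)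
    (hne : B.Nonempty) : ∃ V : ℕ → Set E, IsNormalSeq V ∧ B ⊆ disjointComplement (⋂ n, V n) := by
  obtain ⟨f, rfl⟩ := hc.exists_eq_range hne
  choose V hV hfV using fun i => hB (mem_range_self i)
  refine ⟨diagonalInter V, isNormalSeq_diagonalInter hV, ?_⟩
  rintro _ ⟨i, rfl⟩
  exact disjointComplement_anti (iInter_diagonalInter_subset hV i) (hfV i)

variable [IsOrderedAddMonoid E]

theorem isSolid_carrier : IsSolid (carrier E) :=
  fun _ ⟨V, hV, hx⟩ _ hyx => ⟨V, hV, isSolid_disjointComplement _ hx hyx⟩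

theorem add_mem_carrier {a b : E} (ha : a ∈ carrier E) (hb : b ∈ carrier E) :
    a + b ∈ carrier E := by
  obtain ⟨V, hV, h⟩ := exists_isNormalSeq_of_countable (pair_subset ha hb)
    (to_countable _) (insert_nonempty _ _)
  exact ⟨V, hV, add_mem_disjointComplement (h (mem_insert _ _)) (h (mem_insert_of_mem _ rfl))⟩

theorem zero_mem_carrier : (0 : E) ∈ carrier E :=
  ⟨fun _ => univ, ⟨fun _ => univ_mem, fun _ _ _ _ _ => mem_univ _, fun _ _ _ _ _ => mem_univ _⟩,
    fun _ _ => by simp⟩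

end NormalSequences

/-! ### Locally solid topologies -/

section LocallySolid

variable {E : Type u} [AddCommGroup E] [Module ℝ E] [Lattice E]
  [TopologicalSpace E]

theorem IsLocallySolid.exists_isNormalSeq (h : IsLocallySolid E) (U : ℕ → Set E)
    (hU : ∀ n, U n ∈ 𝓝 (0 : E)) : ∃ V : ℕ → Set E, IsNormalSeq V ∧ ∀ n, V n ⊆ U n := by
  have := h.isTopologicalAddGroup
  have step : ∀ (n : ℕ) (W : {W : Set E // W ∈ 𝓝 (0 : E)}), ∃ W' : {W : Set E // W ∈ 𝓝 (0 : E)},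
      IsSolid W'.1 ∧ W'.1 ⊆ U n ∧ ∀ a ∈ W'.1, ∀ b ∈ W'.1, a + b ∈ W.1 := by
    rintro n ⟨W, hW⟩
    obtain ⟨Y, hY, hYW⟩ := exists_nhds_zero_half hW
    obtain ⟨Z, hZ, hZs, hZY⟩ := h.exists_solid _ (inter_mem hY (hU n))
    exact ⟨⟨Z, hZ⟩, hZs, fun z hz => (hZY hz).2, fun a ha b hb => hYW a (hZY ha).1 b (hZY hb).1⟩
  choose next hs hsub hadd using step
  let F : ℕ → {W : Set E // W ∈ 𝓝 (0 : E)} := fun n =>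
    Nat.rec (next 0 ⟨univ, univ_mem⟩) (fun k W => next (k + 1) W) n
  have hF : ∀ n, IsSolid (F n).1 ∧ (F n).1 ⊆ U n := by
    rintro (_ | n)
    · exact ⟨hs _ _, hsub _ _⟩
    · exact ⟨hs _ _, hsub _ _⟩
  exact ⟨fun n => (F n).1, ⟨fun n => (F n).2, fun n => (hF n).1, fun n => hadd (n + 1) (F n)⟩,
    fun n => (hF n).2⟩

theorem IsLocallySolid.eq_zero_of_forall_mem (h : IsLocallySolid E) {w : E}
    (hw : ∀ V ∈ 𝓝 (0 : E), IsSolid V → w ∈ V) : w = 0 := by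
  have := h.t2Space
  by_contra hne
  obtain ⟨V, hV, hVs, hVU⟩ := h.exists_solid _ (isOpen_compl_singleton.mem_nhds
    (show (0 : E) ∈ ({w}ᶜ : Set E) from fun h0 => hne h0.symm))
  exact hVU (hw V hV hVs) rfl

variable [IsOrderedAddMonoid E]

theorem carrier_eq_univ_of_metrizable (h : IsLocallySolid E)
    [TopologicalSpace.MetrizableSpace E] : carrier E = univ := by
  obtain ⟨U, hU⟩ := (𝓝 (0 : E)).exists_antitone_basis
  obtain ⟨V, hV, hVU⟩ := h.exists_isNormalSeq U hU.mem
  refine eq_univ_of_forall fun x => ⟨V, hV, fun y hy => ?_⟩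
  have : y = 0 := h.eq_zero_of_forall_mem fun W hW _ => by
    obtain ⟨n, hn⟩ := hU.mem_iff.mp hW
    exact hn (hVU n (mem_iInter.mp hy n))
  simp [this]

variable [IsOrderedModule ℝ E]

/-- Here `w ≤ z / (n + 1)`, which tends to 0, so `w` lies in every solid neighbourhood. -/
theorem IsLocallySolid.isArchimedean (h : IsLocallySolid E) : IsArchimedean E := by
  have := h.continuousSMul
  intro w z hw hz
  refine h.eq_zero_of_forall_mem fun V hV hVs => ?_
  have ht : Tendsto (fun n : ℕ => (1 / ((n : ℝ) + 1)) • z) atTop (𝓝 0) := by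
    simpa using (tendsto_one_div_add_atTop_nhds_zero_nat (𝕜 := ℝ)).smul_const z
  obtain ⟨n, hn⟩ := (ht.eventually hV).exists
  refine mem_of_nonneg_of_le hVs hn hw ?_
  have hpos : (0 : ℝ) < (n : ℝ) + 1 := by positivity
  have h1 : ((n : ℝ) + 1) • w ≤ z := by
    have := hz (n + 1)
    rwa [← Nat.cast_smul_eq_nsmul ℝ, Nat.cast_add_one] at this
  have h2 := smul_le_smul_of_nonneg_left h1 (one_div_pos.mpr hpos).le
  rwa [smul_smul, one_div_mul_cancel hpos.ne', one_smul] at h2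

end LocallySolid

/-! ### The carrier and the countable sup property -/

section Lebesgue

variable {E : Type u} [AddCommGroup E] [Module ℝ E] [Lattice E] [IsOrderedAddMonoid E]
  [TopologicalSpace E]

/-- A downward directed set with infimum `0` meets every neighbourhood of `0`. -/
theorem IsUOLebesgue.exists_mem_of_isGLB (h : IsUOLebesgue E) {D : Set E} (hne : D.Nonempty)
    (hdir : ∀ a ∈ D, ∀ b ∈ D, ∃ c ∈ D, c ≤ a ∧ c ≤ b) (hD : IsGLB D 0) {V : Set E}
    (hV : V ∈ 𝓝 (0 : E)) : ∃ d ∈ D, d ∈ V := by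
  have : Nonempty (↥D)ᵒᵈ := let ⟨d, hd⟩ := hne; ⟨OrderDual.toDual ⟨d, hd⟩⟩
  have : IsDirectedOrder (↥D)ᵒᵈ := ⟨fun a b => by
    obtain ⟨c, hc, hca, hcb⟩ := hdir _ (OrderDual.ofDual a).2 _ (OrderDual.ofDual b).2
    exact ⟨OrderDual.toDual ⟨c, hc⟩, hca, hcb⟩⟩
  have huo : UOConv (fun d : (↥D)ᵒᵈ => (OrderDual.ofDual d).1) 0 := by
    refine fun y => orderConv_of_set hne hdir hD fun d hd => ⟨OrderDual.toDual ⟨d, hd⟩, ?_⟩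
    intro i hi
    have hi' : (OrderDual.ofDual i).1 ≤ d := hi
    rw [sub_zero, sub_zero, abs_of_nonneg (hD.1 (OrderDual.ofDual i).2),
      abs_of_nonneg (le_inf (hD.1 (OrderDual.ofDual i).2) (abs_nonneg y))]
    exact inf_le_left.trans hi'
  obtain ⟨i, hi⟩ := ((h.tendsto_of_uoConv _ _ _ huo).eventually hV).exists
  exact ⟨_, (OrderDual.ofDual i).2, hi⟩

theorem countableSupProperty_of_carrier_eq_univ (h : IsUOLebesgue E) (hc : carrier E = univ) :
    CountableSupProperty E := by
  intro S s hS
  rcases S.eq_empty_or_nonempty with rfl | ⟨a₀, ha₀⟩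
  · exact ⟨∅, Subset.rfl, countable_empty, hS⟩
  set D : Set E := {d | ∃ F ⊆ S, F.Finite ∧ IsLUB F (s - d)} with hDdef
  have hD0 : ∀ d ∈ D, 0 ≤ d := by
    rintro d ⟨F, hF, _, hlub⟩
    exact sub_le_self_iff s |>.mp (hlub.2 fun a ha => hS.1 (hF ha))
  have hDS : ∀ a ∈ S, s - a ∈ D := fun a ha =>
    ⟨{a}, singleton_subset_iff.mpr ha, finite_singleton a, by
      rw [sub_sub_cancel]
      exact isLUB_singleton⟩
  have hD : IsGLB D 0 := by
    refine ⟨hD0, fun w hw => ?_⟩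
    have : s ≤ s - w := hS.2 fun a ha => le_sub_comm.mp (hw (hDS a ha))
    exact (le_sub_self_iff s).mp this
  have hdir : ∀ a ∈ D, ∀ b ∈ D, ∃ c ∈ D, c ≤ a ∧ c ≤ b := by
    rintro a ⟨F, hF, hFf, hFl⟩ b ⟨G, hG, hGf, hGl⟩
    refine ⟨a ⊓ b, ⟨F ∪ G, union_subset hF hG, hFf.union hGf, ?_⟩, inf_le_left, inf_le_right⟩
    rw [sub_inf]
    exact hFl.union hGl
  have hd₀ : s - a₀ ∈ D := hDS a₀ ha₀
  obtain ⟨V, hV, hVd⟩ : s - a₀ ∈ carrier E := hc ▸ mem_univ _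
  choose d hd hdV using fun n => h.exists_mem_of_isGLB ⟨_, hd₀⟩ hdir hD (hV.1 n)
  choose F hFS hFf hFl using hd
  refine ⟨insert a₀ (⋃ n, F n), insert_subset ha₀ (iUnion_subset hFS),
    (countable_iUnion fun n => (hFf n).countable).insert _,
    fun a ha => hS.1 (insert_subset ha₀ (iUnion_subset hFS) ha), fun t ht => ?_⟩
  -- The positive part of `s - t` is below every `d n`, hence in the intersection; including `a₀`
  -- keeps it below `s - a₀`, hence in the disjoint complement.
  have h0 : (s - t) ⊔ 0 ≤ s - a₀ :=
    sup_le (sub_le_sub_left (ht (mem_insert _ _)) s) (hD0 _ hd₀)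
  have hn : ∀ n, (s - t) ⊔ 0 ≤ d n := fun n =>
    sup_le (sub_le_comm.mp ((hFl n).2 fun a ha => ht (mem_insert_of_mem _ (mem_iUnion_of_mem n ha))))
      (hD0 _ ⟨F n, hFS n, hFf n, hFl n⟩)
  have hN : (s - t) ⊔ 0 ∈ ⋂ n, V n :=
    mem_iInter.mpr fun n => mem_of_nonneg_of_le (hV.2.1 n) (hdV n) le_sup_right (hn n)
  have hz := eq_zero_of_mem_disjointComplement hN
    (mem_of_nonneg_of_le (isSolid_disjointComplement _) hVd le_sup_right h0)
  exact sub_nonpos.mp (le_sup_left.trans hz.le)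

variable [IsOrderedModule ℝ E]

/-- The carrier is order dense. -/
theorem IsUOLebesgue.exists_mem_carrier (h : IsUOLebesgue E) {w : E} (hw : 0 ≤ w) (hne : w ≠ 0) :
    ∃ z ∈ carrier E, 0 ≤ z ∧ z ≤ w ∧ z ≠ 0 := by
  have hE := h.toIsLocallySolid.isArchimedean
  by_contra! hcon
  refine hne (h.toIsLocallySolid.eq_zero_of_forall_mem fun U hU _ => ?_)
  obtain ⟨V, hV, hVU⟩ := h.toIsLocallySolid.exists_isNormalSeq (fun _ => U) fun _ => hU
  -- With no nonzero positive carrier element below `w`, the intersection itself is order dense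
  -- below `w`.
  have hlub : IsLUB ((⋂ n, V n) ∩ Icc 0 w) w := by
    refine hE.isLUB_of_dense hV.zero_mem_iInter
      (fun a ha b hb => hV.add_mem_iInter ha hb) hw fun v hv hvw hvne => ?_
    have hvN : v ∉ disjointComplement (⋂ n, V n) := fun hv' => hvne (hcon v ⟨V, hV, hv'⟩ hv hvw)
    simp only [disjointComplement, mem_ofPred_eq, not_forall] at hvN
    obtain ⟨y, hy, hvy⟩ := hvN
    rw [abs_of_nonneg hv] at hvy
    refine ⟨v ⊓ |y|, hV.isSolid_iInter hy ?_, le_inf hv (abs_nonneg _), inf_le_left, hvy⟩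
    rw [abs_of_nonneg (le_inf hv (abs_nonneg _))]
    exact inf_le_right
  have hglb : IsGLB {d | ∃ p ∈ (⋂ n, V n) ∩ Icc 0 w, d = w - p} 0 := by
    refine ⟨?_, fun b hb => ?_⟩
    · rintro _ ⟨p, hp, rfl⟩
      exact sub_nonneg.mpr hp.2.2
    · have : w ≤ w - b := hlub.2 fun p hp => le_sub_comm.mp (hb ⟨p, hp, rfl⟩)
      exact (le_sub_self_iff w).mp this
  obtain ⟨_, ⟨p, hp, rfl⟩, hpV⟩ := h.exists_mem_of_isGLB
    (D := {d | ∃ p ∈ (⋂ n, V n) ∩ Icc 0 w, d = w - p})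
    ⟨w, 0, ⟨hV.zero_mem_iInter, le_rfl, hw⟩, (sub_zero w).symm⟩ (by
      rintro _ ⟨p, hp, rfl⟩ _ ⟨q, hq, rfl⟩
      refine ⟨w - p ⊔ q, ⟨p ⊔ q, ⟨?_, hp.2.1.trans le_sup_left, sup_le hp.2.2 hq.2.2⟩, rfl⟩,
        sub_le_sub_left le_sup_left _, sub_le_sub_left le_sup_right _⟩
      refine mem_of_nonneg_of_le hV.isSolid_iInter (hV.add_mem_iInter hp.1 hq.1)
        (hp.2.1.trans le_sup_left) ?_
      exact sup_le (le_add_of_nonneg_right hq.2.1) (le_add_of_nonneg_left hp.2.1)) hglb (hV.1 1)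
  -- Both `w - p` and `p` lie in `V 1`, so `w` lies in `V 0`.
  have := hV.2.2 0 _ hpV p (mem_iInter.mp hp.1 1)
  rw [sub_add_cancel] at this
  exact hVU 0 this

theorem carrier_eq_univ_of_countableSupProperty (h : IsUOLebesgue E)
    (hE : CountableSupProperty E) : carrier E = univ := by
  refine eq_univ_of_forall fun x => mem_of_abs_mem isSolid_carrier ?_
  have hx := abs_nonneg x
  generalize |x| = x at hx
  have hlub : IsLUB (carrier E ∩ Icc 0 x) x :=
    h.toIsLocallySolid.isArchimedean.isLUB_of_dense zero_mem_carrier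
      (fun a ha b hb => add_mem_carrier ha hb) hx
      fun v hv _ hvne => h.exists_mem_carrier hv hvne
  obtain ⟨T, hT, hTc, hTl⟩ := hE _ _ hlub
  -- Adding 0 covers the case of empty `T`.
  obtain ⟨V, hV, hVT⟩ := exists_isNormalSeq_of_countable
    (insert_subset zero_mem_carrier fun t ht => (hT ht).1 : insert 0 T ⊆ carrier E)
    (hTc.insert 0) (insert_nonempty _ _)
  refine ⟨V, hV, fun y hy => ?_⟩
  rw [abs_of_nonneg hx]
  have h0 : 0 ≤ x ⊓ |y| := le_inf hx (abs_nonneg _)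
  refine le_antisymm ?_ h0
  -- Each `t` is disjoint from `x ⊓ |y|`, so their sum stays below `x`.
  have : x ≤ x - x ⊓ |y| := by
    refine hTl.2 fun t ht => le_sub_iff_add_le.mpr ?_
    have h1 := hVT (mem_insert_of_mem _ ht) y hy
    rw [abs_of_nonneg (hT ht).2.1] at h1
    exact add_le_of_inf_eq_zero (inf_eq_zero_of_le h1 (hT ht).2.1 h0 le_rfl inf_le_right)
      (hT ht).2.2 inf_le_left
  exact (le_sub_self_iff x).mp this

/-- For a `V` common to the basis, a nonzero vector of the intersection would dominate in modulus a
nonzero carrier element disjoint from the basis. Hence the intersection is zero. -/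
theorem carrier_eq_univ_of_hasCountableOrderBasis (h : IsUOLebesgue E)
    (hB : HasCountableOrderBasis (carrier E)) : carrier E = univ := by
  obtain ⟨B, hBc, hne, hcount, hB0⟩ := hB
  obtain ⟨V, hV, hVB⟩ := exists_isNormalSeq_of_countable hBc hcount hne
  have hN : ∀ y ∈ ⋂ n, V n, |y| = 0 := by
    intro y hy
    by_contra hy0
    obtain ⟨z, hz, hz0, hzy, hzne⟩ := h.exists_mem_carrier (abs_nonneg y) hy0
    refine hzne (hB0.subset ⟨hz, fun b hb => ?_⟩)
    rw [inf_comm, abs_of_nonneg hz0]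
    exact inf_eq_zero_of_le (hVB hb y hy) (abs_nonneg _) hz0 le_rfl hzy
  refine eq_univ_of_forall fun x => ⟨V, hV, fun y hy => ?_⟩
  rw [hN y hy]
  exact inf_eq_right.mpr (abs_nonneg x)

/-! ### From closure to uo-convergent sequences -/

/-- A sequence in the disjoint complement of `⋂ n, V n` whose `n`-th term is in `V n` is
uo-convergent to zero. -/
theorem IsUOLebesgue.uoConv_of_mem (h : IsUOLebesgue E) {V : ℕ → Set E} (hV : IsNormalSeq V)
    {x : ℕ → E} {l : E} (hx : ∀ n, x n - l ∈ V n)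
    (hxN : ∀ n, x n - l ∈ disjointComplement (⋂ n, V n)) : UOConv x l := by
  have hE := h.toIsLocallySolid.isArchimedean
  intro y
  have hy := abs_nonneg y
  generalize |y| = y at hy
  set D : Set E := {d | ∃ n, ∀ m, n ≤ m → |x m - l| ⊓ y ≤ d} with hDdef
  have hyD : y ∈ D := ⟨0, fun m _ => inf_le_right⟩
  have hD0 : ∀ d ∈ D, 0 ≤ d := by
    rintro d ⟨n, hn⟩
    exact (le_inf (abs_nonneg _) hy).trans (hn n le_rfl)
  have hN : ∀ w, 0 ≤ w → w ∈ lowerBounds D → w ∈ ⋂ n, V n := by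
    refine fun w hw hwD => mem_iInter.mpr fun n => ?_
    -- Truncated tail sums increase and stay in `V (n + 1)`. Their upper bounds belong to `D`, and
    -- one of them is within `V (n + 1)` of some `s k`, hence in `V n`. This replaces a supremum of
    -- `s`, which need not exist.
    set s : ℕ → E := fun k => (∑ j ∈ Finset.range k, |x (n + 1 + 1 + j) - l|) ⊓ y with hs
    have hs0 : ∀ k, 0 ≤ s k := fun k => le_inf (Finset.sum_nonneg fun j _ => abs_nonneg _) hy
    have hsV : ∀ k, s k ∈ V (n + 1) := fun k =>
      mem_of_nonneg_of_le (hV.2.1 _) (hV.sum_mem (a := fun m => |x m - l|)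
        (fun m => hV.2.1 m (hx m) (abs_abs _).le) k (n + 1)) (hs0 k) inf_le_left
    have hsmono : Monotone s := monotone_nat_of_le_succ fun k => inf_le_inf_right _ (by
      rw [Finset.sum_range_succ]
      exact le_add_of_nonneg_right (abs_nonneg _))
    have hUD : ∀ z ∈ upperBounds (range s), z ∈ D := by
      refine fun z hz => ⟨n + 1 + 1, fun m hm => ?_⟩
      obtain ⟨j, rfl⟩ := Nat.exists_eq_add_of_le hm
      refine le_trans (inf_le_inf_right _ ?_) (hz (mem_range_self (j + 1)))
      exact Finset.single_le_sum (f := fun j => |x (n + 1 + 1 + j) - l|)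
        (fun j _ => abs_nonneg _) (Finset.mem_range.mpr j.lt_succ_self)
    have hyU : y ∈ upperBounds (range s) := by
      rintro _ ⟨k, rfl⟩
      exact inf_le_right
    obtain ⟨_, ⟨z, hz, _, ⟨k, rfl⟩, rfl⟩, hzV⟩ := h.exists_mem_of_isGLB
      (D := {d | ∃ z ∈ upperBounds (range s), ∃ a ∈ range s, d = z - a})
      ⟨_, y, hyU, s 0, mem_range_self 0, rfl⟩ (by
        rintro _ ⟨z, hz, _, ⟨k, rfl⟩, rfl⟩ _ ⟨z', hz', _, ⟨k', rfl⟩, rfl⟩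
        refine ⟨_, ⟨z ⊓ z', fun a ha => le_inf (hz ha) (hz' ha), _,
          mem_range_self (max k k'), rfl⟩, ?_, ?_⟩
        · exact sub_le_sub inf_le_left (hsmono (le_max_left _ _))
        · exact sub_le_sub inf_le_right (hsmono (le_max_right _ _)))
      (hE.isGLB_upperBounds_sub (range_nonempty s) ⟨y, hyU⟩) (hV.1 (n + 1))
    have := hV.2.2 n _ hzV _ (hsV k)
    rw [sub_add_cancel] at this
    exact mem_of_nonneg_of_le (hV.2.1 n) this hw (hwD (hUD z hz))
  refine orderConv_of_set ⟨y, hyD⟩ ?_ ⟨hD0, fun w hw => ?_⟩ ?_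
  · rintro a ⟨n, hn⟩ b ⟨m, hm⟩
    exact ⟨a ⊓ b, ⟨max n m, fun k hk => le_inf (hn k ((le_max_left _ _).trans hk))
      (hm k ((le_max_right _ _).trans hk))⟩, inf_le_left, inf_le_right⟩
  · have hw' : w ⊔ 0 ∈ lowerBounds D := fun d hd => sup_le (hw hd) (hD0 d hd)
    have hwN := hN _ le_sup_right hw'
    have : w ⊔ 0 = 0 := by
      -- The terms are disjoint from `w ⊔ 0`, so `d - w ⊔ 0` still dominates the same tail.
      refine hE.eq_zero_of_sub_mem ⟨y, hyD⟩ hD0 le_sup_right fun d hd => ?_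
      obtain ⟨n, hn⟩ := id hd
      refine ⟨n, fun m hm => le_sub_iff_add_le.mpr ?_⟩
      have h1 := hxN m _ hwN
      rw [abs_of_nonneg (le_sup_right : 0 ≤ w ⊔ 0)] at h1
      exact add_le_of_inf_eq_zero (inf_eq_zero_of_le h1 (le_inf (abs_nonneg _) hy) le_sup_right
        inf_le_left le_rfl) (hn m hm) (hw' hd)
    exact le_sup_left.trans this.le
  · rintro d ⟨n, hn⟩
    refine ⟨n, fun m hm => ?_⟩
    rw [sub_zero, abs_of_nonneg (le_inf (abs_nonneg _) hy)]
    exact hn m hm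

theorem IsUOLebesgue.closure_subset_sigmaUOAdherence (h : IsUOLebesgue E)
    (hc : carrier E = univ) (A : Set E) : closure A ⊆ sigmaUOAdherence A := by
  have := h.isTopologicalAddGroup
  intro l hl
  have hmem : ∀ a : E, a ∈ carrier E := fun a => hc ▸ mem_univ a
  choose V hV hVa using hmem
  -- Each term carries a strictly increasing index saying how deep it lies in the normal sequences
  -- of all earlier terms.
  obtain ⟨f, hfA, hf⟩ := exists_seq_of_forall_finset_exists (fun p : ℕ × E => p.2 ∈ A)
    (fun p q => p.1 < q.1 ∧ q.2 - l ∈ V (p.2 - l) q.1) (by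
      intro s _
      set n := s.sup Prod.fst + 1
      have hU : ⋂ p ∈ s, V (p.2 - l) n ∈ 𝓝 (0 : E) :=
        (Filter.biInter_finset_mem s).mpr fun p _ => (hV _).1 n
      have hU' : (fun a => a - l) ⁻¹' (⋂ p ∈ s, V (p.2 - l) n) ∈ 𝓝 l :=
        (continuous_id.sub continuous_const).continuousAt.preimage_mem_nhds (by simpa using hU)
      obtain ⟨a, haU, haA⟩ := mem_closure_iff_nhds.mp hl _ hU'
      exact ⟨(n, a), haA, fun p hp => ⟨Nat.lt_succ_of_le (Finset.le_sup (f := Prod.fst) hp),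
        mem_iInter₂.mp haU p hp⟩⟩)
  have hmono : StrictMono fun n => (f n).1 := fun m n hmn => (hf m n hmn).1
  have hW := isNormalSeq_diagonalInter fun i => hV ((f i).2 - l)
  refine ⟨fun n => (f n).2, hfA, h.uoConv_of_mem hW (fun n => ?_) fun n => ?_⟩
  · exact mem_iInter₂.mpr fun i hi => (hV _).antitone (hmono.id_le n) (hf i n hi).2
  -- The diagonal also contains the normal sequence of the `n`-th term itself.
  · exact disjointComplement_anti (iInter_diagonalInter_subset (fun i => hV ((f i).2 - l)) n)
      (hVa _)

end Lebesgue

/-! ### Comparison of the adherences -/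

section Adherences

variable {E : Type u} [AddCommGroup E] [Lattice E]

theorem sigmaUOAdherence_subset_uoAdherence (A : Set E) :
    sigmaUOAdherence A ⊆ uoAdherence A := by
  rintro l ⟨x, hxA, hx⟩
  exact ⟨ULift.{u} ℕ, inferInstance, ⟨fun a b => ⟨⟨max a.down b.down⟩,
    le_max_left a.down b.down, le_max_right a.down b.down⟩⟩, inferInstance, fun n => x n.down,
    fun n => hxA _, hx.comp ULift.down fun i => ⟨⟨i⟩, fun _ hk => hk⟩⟩

variable [Module ℝ E] [TopologicalSpace E]

theorem IsUOLebesgue.tendsto_of_uoConv_seq (h : IsUOLebesgue E) {x : ℕ → E} {l : E}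
    (hx : UOConv x l) : Tendsto x atTop (𝓝 l) := by
  -- The uo-Lebesgue property speaks of index sets in the universe of `E`, so ℕ is lifted.
  have : IsDirectedOrder (ULift.{u} ℕ) := ⟨fun a b => ⟨⟨max a.down b.down⟩,
    le_max_left a.down b.down, le_max_right a.down b.down⟩⟩
  have h1 := h.tendsto_of_uoConv (ULift.{u} ℕ) (fun n => x n.down) l
    (hx.comp ULift.down fun i => ⟨⟨i⟩, fun _ hk => hk⟩)
  exact h1.comp (tendsto_atTop.mpr fun b => eventually_atTop.mpr ⟨b.down, fun a ha => ha⟩ :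
    Tendsto (ULift.up : ℕ → ULift.{u} ℕ) atTop atTop)

theorem IsUOLebesgue.uoAdherence_subset_closure (h : IsUOLebesgue E) (A : Set E) :
    uoAdherence A ⊆ closure A := by
  rintro l ⟨ι, _, _, _, x, hxA, hx⟩
  exact mem_closure_of_tendsto (h.tendsto_of_uoConv ι x l hx) (Eventually.of_forall hxA)

theorem IsUOLebesgue.sigmaUOAdherence_subset_seqClosure (h : IsUOLebesgue E) (A : Set E) :
    sigmaUOAdherence A ⊆ seqClosure A :=
  fun _ ⟨x, hxA, hx⟩ => ⟨x, hxA, h.tendsto_of_uoConv_seq hx⟩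

end Adherences

/-- If an adherence operator is the closure operator of a topology, then it defines this topology. -/
theorem topologyOfAdherence_eq {X : Type u} [t : TopologicalSpace X] {adh : Set X → Set X}
    (h : ∀ A, adh A = closure A) (h₁ h₂ h₃ h₄) : topologyOfAdherence adh h₁ h₂ h₃ h₄ = t := by
  refine TopologicalSpace.ext_isClosed fun A => ?_
  have hA : IsClosed[topologyOfAdherence adh h₁ h₂ h₃ h₄] A ↔ adh A = A := by
    rw [← @isOpen_compl_iff _ _ (topologyOfAdherence adh h₁ h₂ h₃ h₄)]
    change adh Aᶜᶜ = Aᶜᶜ ↔ adh A = A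
    rw [compl_compl]
  rw [hA, h, closure_eq_iff_isClosed]

end VectorLattice

theorem mainTheorem8 {E : Type u} [AddCommGroup E] [Module ℝ E] [Lattice E] [IsOrderedAddMonoid E]
    [IsOrderedModule ℝ E] [τ : TopologicalSpace E] (hτ : VectorLattice.IsUOLebesgue E) :
    (VectorLattice.carrier E = Set.univ ↔ VectorLattice.CountableSupProperty E) ∧
    (VectorLattice.HasCountableOrderBasis (VectorLattice.carrier E) →
      VectorLattice.carrier E = Set.univ) ∧
    (TopologicalSpace.MetrizableSpace E → VectorLattice.carrier E = Set.univ) ∧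
    (VectorLattice.CountableSupProperty E →
      (∀ A : Set E,
        seqClosure A = closure[τ] A ∧
        closure[VectorLattice.sigmaTopology E] A = closure[τ] A ∧
        VectorLattice.sigmaUOAdherence A = closure[τ] A ∧
        closure[VectorLattice.sigmaUOTopology E] A = closure[τ] A ∧
        VectorLattice.uoAdherence A = closure[τ] A ∧
        closure[VectorLattice.uoTopology E] A = closure[τ] A) ∧
      VectorLattice.sigmaTopology E = τ ∧
      VectorLattice.sigmaUOTopology E = τ ∧
      VectorLattice.uoTopology E = τ) := by
  refine ⟨⟨VectorLattice.countableSupProperty_of_carrier_eq_univ hτ,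
    VectorLattice.carrier_eq_univ_of_countableSupProperty hτ⟩,
    VectorLattice.carrier_eq_univ_of_hasCountableOrderBasis hτ,
    fun _ => VectorLattice.carrier_eq_univ_of_metrizable hτ.toIsLocallySolid, fun hE => ?_⟩
  have hc := VectorLattice.carrier_eq_univ_of_countableSupProperty hτ hE
  have h₁ := hτ.closure_subset_sigmaUOAdherence hc
  have h₂ : ∀ A : Set E, VectorLattice.sigmaUOAdherence A = closure A := fun A =>
    ((VectorLattice.sigmaUOAdherence_subset_uoAdherence A).trans
      (hτ.uoAdherence_subset_closure A)).antisymm (h₁ A)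
  have h₃ : ∀ A : Set E, VectorLattice.uoAdherence A = closure A := fun A =>
    (hτ.uoAdherence_subset_closure A).antisymm
      ((h₁ A).trans (VectorLattice.sigmaUOAdherence_subset_uoAdherence A))
  have h₄ : ∀ A : Set E, seqClosure A = closure A := fun A =>
    seqClosure_subset_closure.antisymm
      ((h₁ A).trans (hτ.sigmaUOAdherence_subset_seqClosure A))
  have e₂ : VectorLattice.sigmaUOTopology E = τ := VectorLattice.topologyOfAdherence_eq h₂ _ _ _ _
  have e₃ : VectorLattice.uoTopology E = τ := VectorLattice.topologyOfAdherence_eq h₃ _ _ _ _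
  have e₄ : VectorLattice.sigmaTopology E = τ := VectorLattice.topologyOfAdherence_eq h₄ _ _ _ _
  refine ⟨fun A => ⟨h₄ A, ?_, h₂ A, ?_, h₃ A, ?_⟩, e₄, e₂, e₃⟩
  · rw [e₄]
  · rw [e₂]
  · rw [e₃]
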